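/- Let $\{e_k\}_{k\in\mathbb Z}$ be the standard orthonormal basis of the complex Hilbert space $\ell^2(\mathbb Z)$, and let $\underline w=\{w_k\}_{k\in\mathbb Z}\subseteq\mathbb C$ be an arbitrary (possibly unbounded) sequence. The bilateral weighted shift $S_{\underline w}$ is the operator with domain \[ \operatorname{dom} S_{\underline w}=\Big\{\sum_{k\in\mathbb Z}\xi_k e_k\in\ell^2(\mathbb Z)\colon \sum_{k\in\mathbb Z}|\xi_k w_k|^2<\infty\Big\},\qquad S_{\underline w}\Big(\sum_{k\in\mathbb Z}\xi_k e_k\Big)=\sum_{k\in\mathbb Z}\xi_{k-1}w_{k-1}\,e_k , \] and the simple bilateral shift $S$ is the one with $w_k=1$ for all $k$. Two (possibly unbounded) operators $A,B$ on $\ell^2(\mathbb Z)$ are called similar if there is a bounded, everywhere defined linear operator $X$ on $\ell^2(\mathbb Z)$ with bounded inverse such that $X(\operatorname{dom}A)=\operatorname{dom}B$ and $XAh=BXh$ for all $h\in\operatorname{dom}A$. A (possibly unbounded) operator $N$ is called normal if it is densely defined, closed, and $N^*N=NN^*$ (equality of domains included). Theorem. Suppose that $S_{\underline w}$ is injective.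 Then the following conditions are equivalent: (a) $S_{\underline w}$ is similar to a normal operator on $\ell^2(\mathbb Z)$; (b) there exists a constant $c>0$ such that $c\cdot S_{\underline w}$ is similar to $S$; (c) there exists a constant $c>0$ such that \[ \sup\Big\{c^n\prod_{j=1}^n|w_{k+j}|\colon k\in\mathbb Z,\ n\in\mathbb N\Big\}<\infty \quad\text{and}\quad \inf\Big\{c^n\prod_{j=1}^n|w_{k+j}|\colon k\in\mathbb Z,\ n\in\mathbb N\Big\}>0 . \] -/

import Mathlib

open scoped ENNReal

noncomputable section

/-- The complex Hilbert space `ℓ²(ℤ)`. -/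
abbrev EllTwoZ : Type := lp (fun _ : ℤ => ℂ) 2

theorem memℓp_two_shift {f : ℤ → ℂ} (hf : Memℓp f 2) :
    Memℓp (fun k : ℤ => f (k - 1)) 2 := by
  have h2 : 0 < (2 : ℝ≥0∞).toReal := by simp
  rw [memℓp_gen_iff h2] at hf ⊢
  exact hf.comp_injective (sub_left_injective (b := (1 : ℤ)))

/-- The (possibly unbounded) bilateral weighted shift with weight sequence `w`: its domain is the
set of all `ξ ∈ ℓ²(ℤ)` such that `(ξ k * w k)` is square summable, and it sends `ξ` to the
sequence whose `k`-th entry is `ξ (k - 1) * w (k - 1)`, so that `e k ↦ w k • e (k + 1)`. -/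
def weightedShift (w : ℤ → ℂ) : EllTwoZ →ₗ.[ℂ] EllTwoZ where
  domain :=
    { carrier := {x | Memℓp (fun k : ℤ => x k * w k) 2}
      add_mem' := by
        intro x y hx hy
        have h := Memℓp.add hx hy
        have e : (fun k : ℤ => (x + y) k * w k)
            = (fun k : ℤ => x k * w k) + (fun k : ℤ => y k * w k) := by
          funext k
          simp [add_mul]
        change Memℓp (fun k : ℤ => (x + y) k * w k) 2
        rw [e]
        exact h
      zero_mem' := by
        have e : (fun k : ℤ => (0 : EllTwoZ) k * w k) = (0 : ℤ → ℂ) := by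
          funext k
          simp
        change Memℓp (fun k : ℤ => (0 : EllTwoZ) k * w k) 2
        rw [e]
        exact zero_memℓp
      smul_mem' := by
        intro a x hx
        have h := Memℓp.const_smul hx a
        have e : (fun k : ℤ => (a • x) k * w k) = a • (fun k : ℤ => x k * w k) := by
          funext k
          simp [mul_assoc]
        change Memℓp (fun k : ℤ => (a • x) k * w k) 2
        rw [e]
        exact h }
  toFun :=
    { toFun := fun x => ⟨fun k : ℤ => (x : EllTwoZ) (k - 1) * w (k - 1),
        memℓp_two_shift (f := fun k : ℤ => (x : EllTwoZ) k * w k) x.2⟩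
      map_add' := by
        intro x y
        apply lp.ext
        funext k
        exact add_mul ((x : EllTwoZ) (k - 1)) ((y : EllTwoZ) (k - 1)) (w (k - 1))
      map_smul' := by
        intro a x
        apply lp.ext
        funext k
        exact mul_assoc a ((x : EllTwoZ) (k - 1)) (w (k - 1)) }

/-- The simple (unweighted) bilateral shift: all weights are equal to `1`. -/
def simpleShift : EllTwoZ →ₗ.[ℂ] EllTwoZ := weightedShift (fun _ => 1)

section Operators

variable {E F G : Type*} [NormedAddCommGroup E] [InnerProductSpace ℂ E]
  [NormedAddCommGroup F] [InnerProductSpace ℂ F]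
  [NormedAddCommGroup G] [InnerProductSpace ℂ G]

/-- The product `B A` of two partially defined operators on its maximal domain
`{x ∈ dom A | A x ∈ dom B}`. -/
def opMul (B : F →ₗ.[ℂ] G) (A : E →ₗ.[ℂ] F) : E →ₗ.[ℂ] G where
  domain :=
    { carrier := {x | ∃ hx : x ∈ A.domain, A ⟨x, hx⟩ ∈ B.domain}
      add_mem' := by
        rintro x y ⟨hx, hx'⟩ ⟨hy, hy'⟩
        refine ⟨add_mem hx hy, ?_⟩
        have e : A ⟨x + y, add_mem hx hy⟩ = A ⟨x, hx⟩ + A ⟨y, hy⟩ := A.map_add ⟨x, hx⟩ ⟨y, hy⟩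
        rw [e]
        exact add_mem hx' hy'
      zero_mem' := by
        refine ⟨zero_mem _, ?_⟩
        have e : A ⟨0, zero_mem _⟩ = 0 := A.map_zero
        rw [e]
        exact zero_mem _
      smul_mem' := by
        rintro a x ⟨hx, hx'⟩
        refine ⟨Submodule.smul_mem _ a hx, ?_⟩
        have e : A ⟨a • x, Submodule.smul_mem _ a hx⟩ = a • A ⟨x, hx⟩ := A.map_smul a ⟨x, hx⟩
        rw [e]
        exact Submodule.smul_mem _ a hx' }
  toFun :=
    { toFun := fun x => B ⟨A ⟨x.1, x.2.1⟩, x.2.2⟩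
      map_add' := by
        intro x y
        rw [← B.map_add]
        congr 1
        exact Subtype.ext (A.map_add ⟨x.1, x.2.1⟩ ⟨y.1, y.2.1⟩)
      map_smul' := by
        intro a x
        rw [RingHom.id_apply, ← B.map_smul]
        congr 1
        exact Subtype.ext (A.map_smul a ⟨x.1, x.2.1⟩) }

/-- A (possibly unbounded) operator `N` on a Hilbert space is normal if it is densely defined,
closed and `N* N = N N*`, equality of domains included. -/
structure IsNormalOp [CompleteSpace E] (N : E →ₗ.[ℂ] E) : Prop where
  dense_domain : Dense (N.domain : Set E)
  isClosed : N.IsClosed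
  comm : opMul N.adjoint N = opMul N N.adjoint

/-- Operators `A` and `B` are similar if there is a bounded operator `X`, everywhere defined and
with bounded inverse, such that `X (dom A) = dom B` and `X A h = B X h` for all `h ∈ dom A`. -/
def SimilarOp (A : E →ₗ.[ℂ] E) (B : F →ₗ.[ℂ] F) : Prop :=
  ∃ X : E ≃L[ℂ] F, X '' (A.domain : Set E) = (B.domain : Set F) ∧
    ∀ (h : A.domain) (g : B.domain), (g : F) = X (h : E) → X (A h) = B g

end Operators

end

/-!
The hard implication is that similarity to a normal operator `N` bounds the normalised products of
the weights from above and below. It is proved without the spectral theorem. A normal operator has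
the same domain as its adjoint, with `‖N x‖ = ‖N* x‖`, so `‖N x‖² = ⟪x, N* N x⟫ ≤ ‖x‖ ‖N² x‖` for
`x ∈ dom N²` (`IsNormalOp.norm_sq_le`), and likewise for `N*`. In other words, the norms along an orbit
of `N` or of `N*` form a log-convex sequence.

Let `X` be the similarity, `f k = X (e k)` and `g k = (X⁻¹)* (e k)`. Since `N (f k) = w k • f (k + 1)`,
log-convexity says that `|w k| ‖f (k + 1)‖ / ‖f k‖` increases with `k`. Since
`N* (g (k + 1)) = conj (w k) • g k`, it says that `|w k| ‖g k‖ / ‖g (k + 1)‖` decreases. Hence the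
sequence `‖f k‖ ‖g k‖` is log-convex; being bounded, it is constant
(`add_one_eq_of_sq_le_of_le`). So the two ratios above agree, and both are equal to a constant `ρ`
(`exists_weight_eq_mul_div`). The product `|w (k + 1)| ⋯ |w (k + n)|` is then
`ρ ^ n ‖f (k + 1)‖ / ‖f (k + n + 1)‖`, where the norms lie between two positive constants, and
`c = ρ⁻¹` works.

Conversely, bounds on the products make a diagonal operator a similarity between `c • S_w` and the
simple shift (`similarOp_simpleShift_of_bounds`), and a multiple of the simple shift is normal.

Unbounded operators are handled through their graphs throughout.
-/

/-! ### Unbounded normal operators -/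

section NormalOperators

variable {E : Type*} [NormedAddCommGroup E] [InnerProductSpace ℂ E]

/-- The orthogonal decomposition of `(u, v)` along a closed subspace `G`, thought of as the graph
of an operator `T`: `(u, v) = (x, T x) + (-T* y', y')` with `y' = v - T x`. Taking `v = 0` shows that
`1 + T* T` is onto, and `u = 0` that `1 + T T*` is onto. -/
theorem exists_mem_sub_mem_adjoint_of_isClosed [CompleteSpace E] {G : Submodule ℂ (E × E)}
    (hG : IsClosed (G : Set (E × E))) (u v : E) :
    ∃ x y z : E, (x, y) ∈ G ∧ (v - y, z) ∈ G.adjoint ∧ u = x - z := by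
  set e := (WithLp.prodContinuousLinearEquiv 2 ℂ E E).symm with he
  set H : Submodule ℂ (WithLp 2 (E × E)) := G.comap (e.symm : WithLp 2 (E × E) →ₗ[ℂ] E × E) with hH
  have hHc : IsClosed (H : Set (WithLp 2 (E × E))) := hG.preimage e.symm.continuous
  have : CompleteSpace H := hHc.completeSpace_coe
  obtain ⟨p, hp, q, hq, hpq⟩ := H.exists_add_mem_mem_orthogonal (WithLp.toLp 2 (u, v))
  have h1 : u = p.fst + q.fst := congrArg WithLp.fst hpq
  have h2 : v = p.snd + q.snd := congrArg WithLp.snd hpq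
  refine ⟨p.fst, p.snd, -q.fst, hp, ?_, by rw [h1]; abel⟩
  rw [Submodule.mem_adjoint_iff]
  intro a b hab
  have := hq (WithLp.toLp 2 (a, b)) hab
  rw [WithLp.prod_inner_apply] at this
  rw [h2, add_sub_cancel_left]
  simp only [inner_neg_right, sub_neg_eq_add]
  rw [add_comm]
  exact this

/-- Let `G` and `H` be the graphs of closed operators `A` and `B` that are formally adjoint to each
other, with `1 + B A` onto and `‖B x‖ = ‖A x‖` for `x` in the domain of `B A`. Then
`dom A ⊆ dom B`, with the same equality of norms on all of `dom A`. The reason is that `dom (B A)` is a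
core of `A`: a vector `(x, A x)` orthogonal to `(z, A z)` for all `z ∈ dom (B A)` satisfies
`⟪x, (1 + B A) z⟫ = 0`, hence `x = 0`. -/
theorem exists_mem_norm_eq_of_formal_adjoint [CompleteSpace E] {G H : Submodule ℂ (E × E)}
    (hG : IsClosed (G : Set (E × E))) (hH : IsClosed (H : Set (E × E)))
    (hadj : ∀ a b c d, (a, b) ∈ G → (c, d) ∈ H → inner ℂ b c = inner ℂ a d)
    (hsurj : ∀ u, ∃ a b c, (a, b) ∈ G ∧ (b, c) ∈ H ∧ u = a + c)
    (hGfun : ∀ d, (0, d) ∈ G → d = 0) (hHfun : ∀ d, (0, d) ∈ H → d = 0)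
    (hcomm : ∀ a b c, (a, b) ∈ G → (b, c) ∈ H → ∃ d, (a, d) ∈ H ∧ ‖d‖ = ‖b‖)
    {x y : E} (hxy : (x, y) ∈ G) : ∃ d, (x, d) ∈ H ∧ ‖d‖ = ‖y‖ := by
  set e := (WithLp.prodContinuousLinearEquiv 2 ℂ E E).symm with he
  set G' : Submodule ℂ (WithLp 2 (E × E)) :=
    G.comap (e.symm : WithLp 2 (E × E) →ₗ[ℂ] E × E) with hG'
  have hG'c : IsClosed (G' : Set (WithLp 2 (E × E))) := hG.preimage e.symm.continuous
  -- The part of the graph `G` lying over the domain of `B A`.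
  let K : Submodule ℂ (WithLp 2 (E × E)) :=
    { carrier := {p | (p.fst, p.snd) ∈ G ∧ ∃ c, (p.snd, c) ∈ H}
      add_mem' := by
        rintro p q ⟨hp, c, hc⟩ ⟨hq, d, hd⟩
        exact ⟨G.add_mem hp hq, c + d, H.add_mem hc hd⟩
      zero_mem' := ⟨G.zero_mem, 0, H.zero_mem⟩
      smul_mem' := by
        rintro a p ⟨hp, c, hc⟩
        exact ⟨G.smul_mem a hp, a • c, H.smul_mem a hc⟩ }
  have hKG : K.topologicalClosure ≤ G' :=
    K.topologicalClosure_minimal (fun p hp => hp.1) hG'c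
  have hKcl : K.topologicalClosure = G' := by
    have : CompleteSpace K.topologicalClosure :=
      K.isClosed_topologicalClosure.completeSpace_coe
    refine le_antisymm hKG ?_
    intro p hp
    obtain ⟨q, hq, r, hr, hpq⟩ := K.topologicalClosure.exists_add_mem_mem_orthogonal p
    have hrG : r ∈ G' := by
      have : r = p - q := by rw [hpq]; abel
      rw [this]
      exact G'.sub_mem hp (hKG hq)
    -- Testing `r` against the `z` with `(1 + B A) z = r.fst` gives `⟪r.fst, r.fst⟫ = 0`.
    obtain ⟨a, b, c, hab, hbc, hu⟩ := hsurj r.fst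
    have h0 := hr (WithLp.toLp 2 (a, b)) (K.le_topologicalClosure ⟨hab, c, hbc⟩)
    rw [WithLp.prod_inner_apply] at h0
    have h1 : inner ℂ b r.snd = inner ℂ c r.fst := by
      have := hadj _ _ _ _ (show (r.fst, r.snd) ∈ G from hrG) hbc
      rw [← inner_conj_symm, this, inner_conj_symm]
    have h2 : inner ℂ r.fst r.fst = (0 : ℂ) := by
      nth_rw 1 [hu]
      rw [inner_add_left, ← h1]
      exact h0
    have h3 : r.fst = 0 := inner_self_eq_zero.mp h2
    have h4 : r.snd = 0 := hGfun _ (by rw [← h3]; exact hrG)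
    have h5 : r = 0 := (WithLp.ofLp_injective 2) (Prod.ext h3 h4)
    rwa [hpq, h5, add_zero]
  have hmem : WithLp.toLp 2 (x, y) ∈ closure (K : Set (WithLp 2 (E × E))) := by
    have : WithLp.toLp 2 (x, y) ∈ K.topologicalClosure := hKcl ▸ (show _ ∈ G' from hxy)
    exact this
  obtain ⟨s, hs, hlim⟩ := mem_closure_iff_seq_limit.mp hmem
  have hfst : Filter.Tendsto (fun n => (s n).fst) Filter.atTop (nhds x) :=
    (continuous_fst.comp e.symm.continuous).continuousAt.tendsto.comp hlim
  have hsnd : Filter.Tendsto (fun n => (s n).snd) Filter.atTop (nhds y) :=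
    (continuous_snd.comp e.symm.continuous).continuousAt.tendsto.comp hlim
  have hex : ∀ n, ∃ d, ((s n).fst, d) ∈ H ∧ ‖d‖ = ‖(s n).snd‖ := fun n => by
    obtain ⟨h1, c, hc⟩ := hs n
    exact hcomm _ _ c h1 hc
  choose d hdH hdn using hex
  have hdiff : ∀ m n, dist (d m) (d n) = dist (s m).snd (s n).snd := fun m n => by
    obtain ⟨h1, c, hc⟩ := K.sub_mem (hs m) (hs n)
    obtain ⟨d', hd', hn'⟩ := hcomm _ _ c h1 hc
    have h0 : ((0 : E), d m - d n - d') ∈ H := by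
      have := H.sub_mem (H.sub_mem (hdH m) (hdH n)) hd'
      simpa using this
    rw [dist_eq_norm, dist_eq_norm, sub_eq_zero.mp (hHfun _ h0), hn']
    rfl
  have hcau : CauchySeq d := by
    rw [Metric.cauchySeq_iff]
    simpa only [hdiff] using Metric.cauchySeq_iff.mp hsnd.cauchySeq
  obtain ⟨z, hz⟩ := cauchySeq_tendsto_of_complete hcau
  refine ⟨z, hH.mem_of_tendsto (hfst.prodMk_nhds hz) (.of_forall hdH), ?_⟩
  refine tendsto_nhds_unique hz.norm ?_
  simpa only [hdn] using hsnd.norm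

theorem mem_graph_opMul {F G : Type*} [NormedAddCommGroup F] [InnerProductSpace ℂ F]
    [NormedAddCommGroup G] [InnerProductSpace ℂ G] {B : F →ₗ.[ℂ] G} {A : E →ₗ.[ℂ] F}
    {x : E} {z : G} :
    (x, z) ∈ (opMul B A).graph ↔ ∃ y, (x, y) ∈ A.graph ∧ (y, z) ∈ B.graph := by
  constructor
  · intro h
    obtain ⟨⟨t, ht, ht'⟩, h1, h2⟩ := (LinearPMap.mem_graph_iff _).mp h
    subst h1
    refine ⟨A ⟨t, ht⟩, A.mem_graph ⟨t, ht⟩, ?_⟩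
    rw [← show _ = z from h2]
    exact B.mem_graph ⟨A ⟨t, ht⟩, ht'⟩
  · rintro ⟨y, h1, h2⟩
    obtain ⟨⟨t, ht⟩, e1, e2⟩ := (LinearPMap.mem_graph_iff _).mp h1
    obtain ⟨⟨t', ht'⟩, e3, e4⟩ := (LinearPMap.mem_graph_iff _).mp h2
    simp only at e1 e2 e3 e4
    subst e1 e3 e4
    have hx : A ⟨t, ht⟩ ∈ B.domain := e2 ▸ ht'
    have h := (opMul B A).mem_graph ⟨t, ht, hx⟩
    have e : (opMul B A) ⟨t, ht, hx⟩ = B ⟨t', ht'⟩ := congrArg B (Subtype.ext e2)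
    rwa [e] at h

variable [CompleteSpace E] {N : E →ₗ.[ℂ] E}

theorem LinearPMap.inner_eq_of_mem_graph_adjoint (hN : Dense (N.domain : Set E)) {a b c d : E}
    (hab : (a, b) ∈ N.graph) (hcd : (c, d) ∈ N.adjoint.graph) : inner ℂ b c = inner ℂ a d := by
  rw [LinearPMap.adjoint_graph_eq_graph_adjoint hN, Submodule.mem_adjoint_iff] at hcd
  exact sub_eq_zero.mp (hcd a b hab)

/-- On `dom N* N = dom N N*` one has `‖N x‖² = ⟪x, N* N x⟫ = ⟪x, N N* x⟫ = ‖N* x‖²`. -/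
theorem IsNormalOp.norm_eq_of_mem_graph_comp (hN : IsNormalOp N) {x y y' z z' : E}
    (hy : (x, y) ∈ N.graph) (hz : (y, z) ∈ N.adjoint.graph)
    (hy' : (x, y') ∈ N.adjoint.graph) (hz' : (y', z') ∈ N.graph) : ‖y‖ = ‖y'‖ := by
  have hzz : z = z' := by
    have h1 := mem_graph_opMul.mpr ⟨y, hy, hz⟩
    have h2 := mem_graph_opMul.mpr ⟨y', hy', hz'⟩
    rw [hN.comm] at h1
    exact LinearPMap.mem_graph_snd_inj _ h1 h2 rfl
  have h1 := LinearPMap.inner_eq_of_mem_graph_adjoint hN.dense_domain hy hz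
  have h2 := LinearPMap.inner_eq_of_mem_graph_adjoint hN.dense_domain hz' hy'
  have h3 : inner ℂ y y = (inner ℂ y' y' : ℂ) := by
    rw [h1, hzz, ← inner_conj_symm, h2, inner_conj_symm]
  rw [inner_self_eq_norm_sq_to_K, inner_self_eq_norm_sq_to_K] at h3
  have h4 : ‖y‖ ^ 2 = ‖y'‖ ^ 2 := by exact_mod_cast h3
  exact (sq_eq_sq₀ (norm_nonneg _) (norm_nonneg _)).mp h4

/-- For normal `N`, `dom N ⊆ dom N*` and `‖N* x‖ = ‖N x‖` on `dom N`. -/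
theorem IsNormalOp.exists_mem_graph_adjoint (hN : IsNormalOp N) {x y : E}
    (h : (x, y) ∈ N.graph) : ∃ d, (x, d) ∈ N.adjoint.graph ∧ ‖d‖ = ‖y‖ := by
  have hd := hN.dense_domain
  refine exists_mem_norm_eq_of_formal_adjoint hN.isClosed (LinearPMap.adjoint_isClosed hd)
    (fun _ _ _ _ => LinearPMap.inner_eq_of_mem_graph_adjoint hd) ?_
    (fun _ hd => N.graph_fst_eq_zero_snd hd rfl)
    (fun _ hd => N.adjoint.graph_fst_eq_zero_snd hd rfl) ?_ h
  · intro u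
    obtain ⟨x, y, z, hxy, hz, hu⟩ := exists_mem_sub_mem_adjoint_of_isClosed hN.isClosed u 0
    rw [← LinearPMap.adjoint_graph_eq_graph_adjoint hd] at hz
    refine ⟨x, y, -z, hxy, ?_, by rw [hu]; abel⟩
    simpa using N.adjoint.graph.neg_mem hz
  · intro a b c hab hbc
    have h1 := mem_graph_opMul.mpr ⟨b, hab, hbc⟩
    rw [hN.comm] at h1
    obtain ⟨b', hb', hc'⟩ := mem_graph_opMul.mp h1
    exact ⟨b', hb', (hN.norm_eq_of_mem_graph_comp hab hbc hb' hc').symm⟩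

/-- For normal `N`, `dom N* ⊆ dom N` and `‖N x‖ = ‖N* x‖` on `dom N*`. -/
theorem IsNormalOp.exists_mem_graph (hN : IsNormalOp N) {x y : E}
    (h : (x, y) ∈ N.adjoint.graph) : ∃ d, (x, d) ∈ N.graph ∧ ‖d‖ = ‖y‖ := by
  have hd := hN.dense_domain
  refine exists_mem_norm_eq_of_formal_adjoint (LinearPMap.adjoint_isClosed hd) hN.isClosed
    (fun a b c d hab hcd => ?_) ?_
    (fun _ hd => N.adjoint.graph_fst_eq_zero_snd hd rfl)
    (fun _ hd => N.graph_fst_eq_zero_snd hd rfl) ?_ h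
  · rw [← inner_conj_symm, ← LinearPMap.inner_eq_of_mem_graph_adjoint hd hcd hab, inner_conj_symm]
  · intro u
    obtain ⟨x, y, z, hxy, hz, hu⟩ := exists_mem_sub_mem_adjoint_of_isClosed hN.isClosed 0 u
    rw [← LinearPMap.adjoint_graph_eq_graph_adjoint hd, ← sub_eq_zero.mp hu.symm] at hz
    exact ⟨u - y, x, y, hz, hxy, by abel⟩
  · intro a b c hab hbc
    have h1 := mem_graph_opMul.mpr ⟨b, hab, hbc⟩
    rw [← hN.comm] at h1
    obtain ⟨b', hb', hc'⟩ := mem_graph_opMul.mp h1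
    exact ⟨b', hb', hN.norm_eq_of_mem_graph_comp hb' hc' hab hbc⟩

/-- Log-convexity of orbits: `‖N x‖² ≤ ‖x‖ ‖N² x‖` for normal `N` and `x ∈ dom N²`. -/
theorem IsNormalOp.norm_sq_le (hN : IsNormalOp N) {x y z : E}
    (hxy : (x, y) ∈ N.graph) (hyz : (y, z) ∈ N.graph) : ‖y‖ ^ 2 ≤ ‖x‖ * ‖z‖ := by
  obtain ⟨d, hd, hdz⟩ := hN.exists_mem_graph_adjoint hyz
  have h := LinearPMap.inner_eq_of_mem_graph_adjoint hN.dense_domain hxy hd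
  have hy : ‖y‖ ^ 2 = ‖(inner ℂ y y : ℂ)‖ := by simp [inner_self_eq_norm_sq_to_K]
  rw [← hdz, hy, h]
  exact norm_inner_le_norm _ _

theorem IsNormalOp.norm_sq_le_adjoint (hN : IsNormalOp N) {x y z : E}
    (hxy : (x, y) ∈ N.adjoint.graph) (hyz : (y, z) ∈ N.adjoint.graph) :
    ‖y‖ ^ 2 ≤ ‖x‖ * ‖z‖ := by
  obtain ⟨d, hd, hdz⟩ := hN.exists_mem_graph hyz
  have h := LinearPMap.inner_eq_of_mem_graph_adjoint hN.dense_domain hd hxy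
  have hy : ‖y‖ ^ 2 = ‖(inner ℂ y y : ℂ)‖ := by simp [inner_self_eq_norm_sq_to_K]
  rw [← hdz, hy, ← h, mul_comm]
  exact norm_inner_le_norm _ _

theorem isNormalOp_toPMap (A : E →L[ℂ] E) (hA : IsStarNormal A) :
    IsNormalOp ((A : E →ₗ[ℂ] E).toPMap ⊤) where
  dense_domain := by simp
  isClosed := by
    have : (((A : E →ₗ[ℂ] E).toPMap ⊤).graph : Set (E × E)) = {p | A p.1 = p.2} := by
      ext p
      simp [LinearPMap.mem_graph_iff]
    rw [LinearPMap.IsClosed, this]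
    exact isClosed_eq (by fun_prop) (by fun_prop)
  comm := by
    rw [A.toPMap_adjoint_eq_adjoint_toPMap_of_dense (by simp)]
    refine LinearPMap.ext ?_ ?_
    · ext x
      exact ⟨fun _ => ⟨trivial, trivial⟩, fun _ => ⟨trivial, trivial⟩⟩
    · intro x hx hx'
      exact congrArg (fun T : E →L[ℂ] E => T x) hA.star_comm_self

end NormalOperators

/-! ### Log-convex sequences and products of weights -/

section RealSequences

/-- A positive log-convex sequence on `ℤ` which is bounded above is constant: its consecutive
ratios are monotone, so a ratio other than `1` forces geometric growth in one direction. -/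
theorem add_one_eq_of_sq_le_of_le {t : ℤ → ℝ} {M : ℝ} (ht : ∀ k, 0 < t k)
    (hconv : ∀ k, t k ^ 2 ≤ t (k - 1) * t (k + 1)) (hM : ∀ k, t k ≤ M) (k : ℤ) :
    t (k + 1) = t k := by
  -- The inequality is reflected by `k ↦ -k` below to get the reverse one.
  have key : ∀ s : ℤ → ℝ, (∀ k, 0 < s k) → (∀ k, s k ^ 2 ≤ s (k - 1) * s (k + 1)) →
      (∀ k, s k ≤ M) → ∀ k, s (k + 1) ≤ s k := by
    intro s hs hc hb k
    by_contra! hlt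
    set θ := s (k + 1) / s k with hθ
    have hθ1 : 1 < θ := (one_lt_div (hs k)).mpr hlt
    have hstep : ∀ n : ℕ, θ * s (k + n) ≤ s (k + n + 1) := by
      intro n
      induction n with
      | zero => simp [hθ, (hs k).ne']
      | succ n ih =>
        have h := hc (k + n + 1)
        rw [add_sub_cancel_right] at h
        push_cast
        rw [← add_assoc]
        have h1 := hs (k + n)
        have h2 := hs (k + n + 1)
        have h3 : θ * s (k + n) * s (k + n + 1) ≤ s (k + n) * s (k + n + 1 + 1) := by
          nlinarith
        nlinarith
    have hgrow : ∀ n : ℕ, θ ^ n * s k ≤ s (k + n) := by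
      intro n
      induction n with
      | zero => simp
      | succ n ih =>
        have h := hstep n
        push_cast
        rw [← add_assoc, pow_succ']
        nlinarith
    obtain ⟨n, hn⟩ := pow_unbounded_of_one_lt (M / s k) hθ1
    have := (div_lt_iff₀ (hs k)).mp hn
    linarith [hgrow n, hb (k + n)]
  refine le_antisymm (key t ht hconv hM k) ?_
  have := key (fun j => t (-j)) (fun j => ht _) (fun j => ?_) (fun j => hM _) (-(k + 1))
  · simpa using this
  · have h := hconv (-j)
    rw [mul_comm] at h
    convert h using 3 <;> ring

theorem eq_apply_zero_of_add_one_eq {t : ℤ → ℝ} (h : ∀ k, t (k + 1) = t k) (k : ℤ) :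
    t k = t 0 := by
  induction k using Int.induction_on with
  | zero => rfl
  | succ n ih => rw [h, ih]
  | pred n ih => rw [← ih, ← h, sub_add_cancel]

/-- If `ω k * a (k + 1) / a k` is monotone, `ω k * b k / b (k + 1)` is antitone, and `a * b` is
bounded, then both ratios are constant. Indeed their quotient is the ratio of consecutive terms of
`a * b`, which is therefore log-convex and bounded, hence constant. -/
theorem exists_weight_eq_mul_div {ω a b : ℤ → ℝ} {M : ℝ} (hω : ∀ k, 0 < ω k)
    (ha : ∀ k, 0 < a k) (hb : ∀ k, 0 < b k) (hM : ∀ k, a k * b k ≤ M)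
    (hA : ∀ k, ω (k - 1) * a k ^ 2 ≤ ω k * (a (k - 1) * a (k + 1)))
    (hB : ∀ k, ω k * b k ^ 2 ≤ ω (k - 1) * (b (k - 1) * b (k + 1))) :
    ∃ ρ, 0 < ρ ∧ ∀ k, ω k = ρ * a k / a (k + 1) := by
  have hab := add_one_eq_of_sq_le_of_le (t := fun k => a k * b k)
    (fun k => mul_pos (ha k) (hb k)) (fun k => ?_) hM
  · have hρ : ∀ k, ω (k + 1) * a (k + 1 + 1) / a (k + 1) = ω k * a (k + 1) / a k := by
      intro k
      have h0 := ha k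
      have h1 := ha (k + 1)
      have h2 := ha (k + 1 + 1)
      have hA' := hA (k + 1)
      have hB' := hB (k + 1)
      rw [add_sub_cancel_right] at hA' hB'
      have e1 : b (k + 1) = a k * b k / a (k + 1) := by
        rw [eq_div_iff h1.ne', mul_comm, hab k]
      have e2 : b (k + 1 + 1) = a k * b k / a (k + 1 + 1) := by
        rw [eq_div_iff h2.ne', mul_comm, hab (k + 1), hab k]
      have hk := hb k
      rw [e1, e2] at hB'
      have hB'' : ω (k + 1) * (a k * a (k + 1 + 1)) ≤ ω k * a (k + 1) ^ 2 := by
        have e3 : ω (k + 1) * (a k * b k / a (k + 1)) ^ 2 =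
            ω (k + 1) * (a k * a (k + 1 + 1)) * (a k * b k ^ 2 /
              (a (k + 1) ^ 2 * a (k + 1 + 1))) := by
          field_simp
        have e4 : ω k * (b k * (a k * b k / a (k + 1 + 1))) =
            ω k * a (k + 1) ^ 2 * (a k * b k ^ 2 / (a (k + 1) ^ 2 * a (k + 1 + 1))) := by
          field_simp
        rw [e3, e4] at hB'
        exact le_of_mul_le_mul_right hB' (by positivity)
      rw [div_eq_div_iff h1.ne' h0.ne']
      linarith
    have hconst := eq_apply_zero_of_add_one_eq
      (t := fun k => ω k * a (k + 1) / a k) hρ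
    refine ⟨ω 0 * a (0 + 1) / a 0, div_pos (mul_pos (hω _) (ha _)) (ha _), fun k => ?_⟩
    have hk := hconst k
    rw [← hk]
    have h0 := ha k
    have h1 := ha (k + 1)
    field_simp
  · have h := mul_le_mul (hA k) (hB k) (mul_nonneg (hω _).le (sq_nonneg _))
      (mul_nonneg (hω _).le (mul_nonneg (ha _).le (ha _).le))
    have hp : 0 < ω (k - 1) * ω k := mul_pos (hω _) (hω _)
    refine le_of_mul_le_mul_left ?_ hp
    calc _ = _ := by ring
      _ ≤ _ := h
      _ = _ := by ring

theorem pow_mul_prod_eq_div {ω a : ℤ → ℝ} {ρ : ℝ} (hρ : 0 < ρ) (ha : ∀ k, 0 < a k)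
    (h : ∀ k, ω k = ρ * a k / a (k + 1)) (k : ℤ) (n : ℕ) :
    ρ⁻¹ ^ n * ∏ j ∈ Finset.Icc 1 n, ω (k + (j : ℤ)) = a (k + 1) / a (k + n + 1) := by
  induction n with
  | zero => simp [(ha _).ne']
  | succ n ih =>
    rw [Finset.prod_Icc_succ_top (by omega), pow_succ,
      show ρ⁻¹ ^ n * ρ⁻¹ * ((∏ j ∈ Finset.Icc 1 n, ω (k + (j : ℤ))) * ω (k + ((n + 1 : ℕ) : ℤ))) =
        (ρ⁻¹ ^ n * ∏ j ∈ Finset.Icc 1 n, ω (k + (j : ℤ))) *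
          (ρ⁻¹ * ω (k + ((n + 1 : ℕ) : ℤ))) by ring, ih, h]
    push_cast
    rw [← add_assoc]
    have h1 := (ha (k + n + 1)).ne'
    have h2 := (ha (k + n + 1 + 1)).ne'
    field_simp

/-- The solution of the recurrence `p (k + 1) = v k * p k` on `ℤ` with `p 0 = 1`, for a nowhere
vanishing `v`: `v 0 ⋯ v (k - 1)` for `k ≥ 0`, and `(v (-1) ⋯ v k)⁻¹` for `k < 0`. Truncation in
`Int.toNat` makes one of the two products empty. -/
noncomputable def intProd (v : ℤ → ℂ) (k : ℤ) : ℂ :=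
  (∏ j ∈ Finset.range k.toNat, v j) / ∏ j ∈ Finset.range (-k).toNat, v (-(j : ℤ) - 1)

theorem intProd_ne_zero {v : ℤ → ℂ} (hv : ∀ k, v k ≠ 0) (k : ℤ) : intProd v k ≠ 0 :=
  div_ne_zero (Finset.prod_ne_zero_iff.mpr fun _ _ => hv _)
    (Finset.prod_ne_zero_iff.mpr fun _ _ => hv _)

theorem intProd_add_one {v : ℤ → ℂ} (hv : ∀ k, v k ≠ 0) (k : ℤ) :
    intProd v (k + 1) = v k * intProd v k := by
  obtain ⟨n, rfl | rfl⟩ : ∃ n : ℕ, k = n ∨ k = -(n : ℤ) - 1 := by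
    rcases le_or_gt 0 k with h | h
    · exact ⟨k.toNat, Or.inl (by omega)⟩
    · exact ⟨(-k - 1).toNat, Or.inr (by omega)⟩
  · have h1 : ((n : ℤ) + 1).toNat = n + 1 := by omega
    have h2 : (-((n : ℤ) + 1)).toNat = 0 := by omega
    have h3 : (-(n : ℤ)).toNat = 0 := by omega
    simp only [intProd, h1, h2, h3, Int.toNat_natCast, Finset.prod_range_succ,
      Finset.prod_range_zero, div_one, mul_comm]
  · have h1 : (-(n : ℤ) - 1 + 1).toNat = 0 := by omega
    have h2 : (-(-(n : ℤ) - 1 + 1)).toNat = n := by omega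
    have h3 : (-(n : ℤ) - 1).toNat = 0 := by omega
    have h4 : (-(-(n : ℤ) - 1)).toNat = n + 1 := by omega
    have := hv (-(n : ℤ) - 1)
    simp only [intProd, h1, h2, h3, h4, Finset.prod_range_succ]
    rw [Finset.prod_range_zero]
    field_simp

end RealSequences

/-! ### Weighted shifts -/

section Shifts

/-- The standard basis vector `e k` of `ℓ²(ℤ)`. -/
noncomputable def stdVec (k : ℤ) : EllTwoZ := lp.single 2 k (1 : ℂ)

theorem norm_stdVec (k : ℤ) : ‖stdVec k‖ = 1 := by
  rw [stdVec, lp.norm_single (by norm_num), norm_one]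

theorem inner_stdVec (k : ℤ) (x : EllTwoZ) : inner ℂ (stdVec k) x = x k := by
  rw [stdVec, lp.inner_single_left]; simp

theorem memℓp_two_add_one {f : ℤ → ℂ} (hf : Memℓp f 2) : Memℓp (fun k : ℤ => f (k + 1)) 2 := by
  have h2 : 0 < (2 : ℝ≥0∞).toReal := by simp
  rw [memℓp_gen_iff h2] at hf ⊢
  exact hf.comp_injective (add_left_injective (1 : ℤ))

theorem mem_graph_weightedShift {w : ℤ → ℂ} {x y : EllTwoZ} :
    (x, y) ∈ (weightedShift w).graph ↔ ∀ k, y (k + 1) = x k * w k := by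
  refine ⟨fun h k => ?_, fun h => ?_⟩
  · obtain ⟨t, h1, h2⟩ := (LinearPMap.mem_graph_iff _).mp h
    simp only at h1 h2
    subst h1 h2
    change (t : EllTwoZ) (k + 1 - 1) * w (k + 1 - 1) = _
    rw [add_sub_cancel_right]
  have hx : x ∈ (weightedShift w).domain := by
    change Memℓp (fun k : ℤ => x k * w k) 2
    simp only [← h]
    exact memℓp_two_add_one (lp.memℓp y)
  rw [LinearPMap.mem_graph_iff]
  refine ⟨⟨x, hx⟩, rfl, lp.ext (funext fun k => ?_)⟩
  change x (k - 1) * w (k - 1) = y k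
  rw [← h, sub_add_cancel]

theorem stdVec_mem_graph (w : ℤ → ℂ) (k : ℤ) :
    (stdVec k, w k • stdVec (k + 1)) ∈ (weightedShift w).graph := by
  rw [mem_graph_weightedShift]
  intro j
  by_cases h : j = k
  · subst h; simp [stdVec]
  · simp [stdVec, h]

theorem weight_ne_zero_of_injective {w : ℤ → ℂ} (hw : Function.Injective (weightedShift w)) (k : ℤ) :
    w k ≠ 0 := by
  intro h0
  have h := stdVec_mem_graph w k
  rw [h0, zero_smul] at h
  obtain ⟨t, h1, h2⟩ := (LinearPMap.mem_graph_iff _).mp h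
  have ht : t = 0 := hw (by rw [h2, LinearPMap.map_zero])
  have := norm_stdVec k
  rw [← show (t : EllTwoZ) = stdVec k from h1, ht] at this
  simp at this

/-- Similarity in terms of graphs: `X × X` maps the graph of `A` onto that of `B`. -/
theorem similarOp_iff_graph {E F : Type*} [NormedAddCommGroup E] [InnerProductSpace ℂ E]
    [NormedAddCommGroup F] [InnerProductSpace ℂ F] {A : E →ₗ.[ℂ] E} {B : F →ₗ.[ℂ] F} :
    SimilarOp A B ↔ ∃ X : E ≃L[ℂ] F, ∀ x y, (x, y) ∈ A.graph ↔ (X x, X y) ∈ B.graph := by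
  constructor
  · rintro ⟨X, hdom, hX⟩
    have hmp : ∀ x y, (x, y) ∈ A.graph → (X x, X y) ∈ B.graph := fun x y h => by
      obtain ⟨t, h1, h2⟩ := (LinearPMap.mem_graph_iff _).mp h
      simp only at h1 h2
      subst h1 h2
      have hm : X t ∈ B.domain := by
        have : X t ∈ (B.domain : Set F) := hdom ▸ Set.mem_image_of_mem X t.2
        exact this
      rw [hX t ⟨X t, hm⟩ rfl]
      exact B.mem_graph ⟨X t, hm⟩
    refine ⟨X, fun x y => ⟨hmp x y, fun h => ?_⟩⟩
    have hm : X x ∈ X '' (A.domain : Set E) := hdom ▸ LinearPMap.mem_domain_of_mem_graph h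
    obtain ⟨x', hx', he⟩ := hm
    have h' := A.mem_graph ⟨x', hx'⟩
    have h2 := LinearPMap.mem_graph_snd_inj _ (hmp _ _ h') h he
    rw [← X.injective he, ← X.injective h2]
    exact h'
  · rintro ⟨X, hX⟩
    refine ⟨X, ?_, fun h g hg => ?_⟩
    · ext z
      constructor
      · rintro ⟨x, hx, rfl⟩
        exact LinearPMap.mem_domain_of_mem_graph ((hX _ _).mp (A.mem_graph ⟨x, hx⟩))
      · intro hz
        have h := B.mem_graph ⟨z, hz⟩
        refine ⟨X.symm z, ?_, X.apply_symm_apply z⟩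
        refine LinearPMap.mem_domain_of_mem_graph (y := X.symm (B ⟨z, hz⟩)) ?_
        rw [hX, X.apply_symm_apply, X.apply_symm_apply]
        exact h
    · exact LinearPMap.mem_graph_snd_inj _ ((hX _ _).mp (A.mem_graph h)) (B.mem_graph g) hg.symm

theorem mem_graph_smul {E F : Type*} [NormedAddCommGroup E] [InnerProductSpace ℂ E]
    [NormedAddCommGroup F] [InnerProductSpace ℂ F] {A : E →ₗ.[ℂ] F} {c : ℂ} (hc : c ≠ 0)
    {x : E} {y : F} : (x, y) ∈ (c • A).graph ↔ (x, c⁻¹ • y) ∈ A.graph := by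
  simp only [LinearPMap.mem_graph_iff, LinearPMap.smul_apply]
  constructor
  · rintro ⟨t, h1, h2⟩
    exact ⟨t, h1, by rw [← h2, inv_smul_smul₀ hc]⟩
  · rintro ⟨t, h1, h2⟩
    exact ⟨t, h1, by rw [eq_inv_smul_iff₀ hc] at h2; exact h2⟩

/-- The invertible diagonal operator `e k ↦ d k • e k`, for `d` bounded with bounded inverse. -/
noncomputable def diagEquiv (d : ℤ → ℂ) {K : ℝ} (hK : 0 ≤ K) (h0 : ∀ k, d k ≠ 0)
    (hd : ∀ k, ‖d k‖ ≤ K) (hd' : ∀ k, ‖(d k)⁻¹‖ ≤ K) : EllTwoZ ≃L[ℂ] EllTwoZ :=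
  .equivOfInverse
    (lp.mapCLM 2 (fun k => ContinuousLinearMap.mul ℂ ℂ (d k)) hK (by simpa using hd))
    (lp.mapCLM 2 (fun k => ContinuousLinearMap.mul ℂ ℂ (d k)⁻¹) hK (by simpa using hd'))
    (fun x => lp.ext (funext fun k => inv_mul_cancel_left₀ (h0 k) _))
    (fun x => lp.ext (funext fun k => mul_inv_cancel_left₀ (h0 k) _))

theorem diagEquiv_apply (d : ℤ → ℂ) {K : ℝ} (hK : 0 ≤ K) (h0 : ∀ k, d k ≠ 0)
    (hd : ∀ k, ‖d k‖ ≤ K) (hd' : ∀ k, ‖(d k)⁻¹‖ ≤ K) (x : EllTwoZ) (k : ℤ) :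
    diagEquiv d hK h0 hd hd' x k = d k * x k := rfl

/-- The simple bilateral shift as a unitary operator on `ℓ²(ℤ)`. -/
noncomputable def shiftIsometryEquiv : EllTwoZ ≃ₗᵢ[ℂ] EllTwoZ where
  toFun x := ⟨fun k => x (k - 1), memℓp_two_shift (lp.memℓp x)⟩
  invFun x := ⟨fun k => x (k + 1), memℓp_two_add_one (lp.memℓp x)⟩
  map_add' _ _ := rfl
  map_smul' _ _ := rfl
  left_inv x := lp.ext (funext fun k => congrArg x (add_sub_cancel_right k 1))
  right_inv x := lp.ext (funext fun k => congrArg x (sub_add_cancel k 1))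
  norm_map' x := by
    have h2 : 0 < (2 : ℝ≥0∞).toReal := by simp
    rw [lp.norm_eq_tsum_rpow h2, lp.norm_eq_tsum_rpow h2]
    congr 1
    exact (Equiv.subRight (1 : ℤ)).tsum_eq (fun k => ‖x k‖ ^ (2 : ℝ≥0∞).toReal)

theorem shiftIsometryEquiv_apply (x : EllTwoZ) (k : ℤ) : shiftIsometryEquiv x k = x (k - 1) := rfl

theorem mem_graph_simpleShift {x y : EllTwoZ} :
    (x, y) ∈ simpleShift.graph ↔ shiftIsometryEquiv x = y := by
  rw [simpleShift, mem_graph_weightedShift]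
  constructor
  · intro h
    refine lp.ext (funext fun k => ?_)
    have := h (k - 1)
    rw [sub_add_cancel, mul_one] at this
    exact this.symm
  · rintro rfl k
    rw [shiftIsometryEquiv_apply, add_sub_cancel_right, mul_one]

theorem isStarNormal_smul_shiftIsometryEquiv (c : ℂ) :
    IsStarNormal (c • (shiftIsometryEquiv : EllTwoZ →L[ℂ] EllTwoZ)) := by
  have : IsStarNormal (shiftIsometryEquiv : EllTwoZ →L[ℂ] EllTwoZ) := by
    refine ⟨?_⟩
    rw [ContinuousLinearMap.star_eq_adjoint, LinearIsometryEquiv.adjoint_eq_symm]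
    ext x
    simp
  infer_instance

theorem exists_isNormalOp_of_similarOp_simpleShift {A : EllTwoZ →ₗ.[ℂ] EllTwoZ} {c : ℂ}
    (hc : c ≠ 0) (h : SimilarOp (c • A) simpleShift) :
    ∃ N : EllTwoZ →ₗ.[ℂ] EllTwoZ, IsNormalOp N ∧ SimilarOp A N := by
  obtain ⟨X, hX⟩ := similarOp_iff_graph.mp h
  refine ⟨_, isNormalOp_toPMap (c⁻¹ • (shiftIsometryEquiv : EllTwoZ →L[ℂ] EllTwoZ))
    (isStarNormal_smul_shiftIsometryEquiv c⁻¹), ?_⟩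
  refine similarOp_iff_graph.mpr ⟨X, fun x y => ?_⟩
  have h1 := hX x (c • y)
  rw [mem_graph_smul hc, inv_smul_smul₀ hc, mem_graph_simpleShift, map_smul] at h1
  rw [h1, LinearPMap.mem_graph_iff]
  simp [inv_smul_eq_iff₀ hc]

/-- The similarity is diagonal, `e k ↦ (p k)⁻¹ • e k` with `p (k + 1) = c * w k * p k`; the bounds on
the products of weights say that `p` and `p⁻¹` are bounded. -/
theorem similarOp_simpleShift_of_bounds {w : ℤ → ℂ} (hw : ∀ k, w k ≠ 0) {c : ℝ} (hc : 0 < c)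
    {M δ : ℝ} (hδ : 0 < δ)
    (hM : ∀ (k : ℤ) (n : ℕ), c ^ n * ∏ j ∈ Finset.Icc 1 n, ‖w (k + (j : ℤ))‖ ≤ M)
    (hm : ∀ (k : ℤ) (n : ℕ), δ ≤ c ^ n * ∏ j ∈ Finset.Icc 1 n, ‖w (k + (j : ℤ))‖) :
    SimilarOp ((c : ℂ) • weightedShift w) simpleShift := by
  have hc' : (c : ℂ) ≠ 0 := by exact_mod_cast hc.ne'
  set p := intProd (fun k => c * w k) with hp
  have hv : ∀ k, (c : ℂ) * w k ≠ 0 := fun k => mul_ne_zero hc' (hw k)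
  have hp1 : ∀ k, p (k + 1) = c * w k * p k := intProd_add_one hv
  have hp0 : ∀ k, p k ≠ 0 := intProd_ne_zero hv
  have hpn : p 0 = 1 := by simp [hp, intProd]
  -- The weights are `c⁻¹ ‖(p k)⁻¹‖ / ‖(p (k + 1))⁻¹‖`, so the products compare two values of `p`;
  -- taking one of the two indices to be `0`, where `p 0 = 1`, bounds the other value.
  have hprod := pow_mul_prod_eq_div (ω := fun k => ‖w k‖) (a := fun k => ‖(p k)⁻¹‖)
    (inv_pos.mpr hc) (fun k => norm_pos_iff.mpr (inv_ne_zero (hp0 k))) (fun k => by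
      have h1 := norm_pos_iff.mpr (hp0 k)
      have h2 := norm_pos_iff.mpr (hw k)
      simp only [hp1, norm_inv, norm_mul, Complex.norm_real, Real.norm_of_nonneg hc.le]
      field_simp)
  simp only [inv_inv] at hprod
  have hM1 : 1 ≤ M := by simpa using hM 0 0
  set K := max M δ⁻¹ with hK
  have hK0 : 0 ≤ K := le_trans (by linarith) (le_max_left M δ⁻¹)
  have hbound : ∀ k, ‖p k‖ ≤ K ∧ ‖(p k)⁻¹‖ ≤ K := by
    intro k
    obtain ⟨n, rfl | rfl⟩ := k.eq_nat_or_neg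
    · have h1 := hM (-1) n
      have h2 := hm (-1) n
      rw [hprod] at h1 h2
      simp only [neg_add_cancel, hpn, inv_one, norm_one, neg_add_cancel_comm, one_div,
        norm_inv, inv_inv] at h1 h2
      exact ⟨h1.trans (le_max_left _ _),
        (norm_inv (p n)).le.trans ((inv_anti₀ hδ h2).trans (le_max_right _ _))⟩
    · have h1 := hM (-(n : ℤ) - 1) n
      have h2 := hm (-(n : ℤ) - 1) n
      rw [hprod, show -(n : ℤ) - 1 + n + 1 = 0 by ring, hpn, sub_add_cancel] at h1 h2
      simp only [inv_one, norm_one, div_one] at h1 h2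
      refine ⟨?_, h1.trans (le_max_left _ _)⟩
      rw [norm_inv] at h2
      exact ((le_inv_comm₀ hδ (norm_pos_iff.mpr (hp0 _))).mp h2).trans (le_max_right _ _)
  refine similarOp_iff_graph.mpr
    ⟨diagEquiv (fun k => (p k)⁻¹) hK0 (fun k => inv_ne_zero (hp0 k)) (fun k => (hbound k).2)
      (fun k => by rw [inv_inv]; exact (hbound k).1), fun x y => ?_⟩
  rw [mem_graph_smul hc', simpleShift, mem_graph_weightedShift, mem_graph_weightedShift]
  refine forall_congr' fun k => ?_
  rw [diagEquiv_apply, diagEquiv_apply, hp1, lp.coeFn_smul, Pi.smul_apply, smul_eq_mul]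
  have h1 := hp0 k
  have h2 := hw k
  constructor
  · intro h
    rw [← mul_right_inj' h1, mul_one, mul_inv_cancel_left₀ h1]
    rw [inv_mul_eq_iff_eq_mul₀ hc'] at h
    rw [h]
    field_simp
  · intro h
    field_simp at h ⊢
    rw [h]

/-- If `X` carries the shift to a normal `N`, then `f k = X (e k)` and `g k = (X⁻¹)* (e k)` satisfy
`N (f k) = w k • f (k + 1)` and `N* (g (k + 1)) = conj (w k) • g k`. Log-convexity of the orbits of
`N` and `N*` gives the monotonicity required by `exists_weight_eq_mul_div`. -/
theorem exists_bounds_of_similarOp_isNormalOp {w : ℤ → ℂ} (hw : ∀ k, w k ≠ 0)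
    {N : EllTwoZ →ₗ.[ℂ] EllTwoZ} (hN : IsNormalOp N) (h : SimilarOp (weightedShift w) N) :
    ∃ c : ℝ, 0 < c ∧
      (∃ M : ℝ, ∀ (k : ℤ) (n : ℕ), c ^ n * ∏ j ∈ Finset.Icc 1 n, ‖w (k + (j : ℤ))‖ ≤ M) ∧
      (∃ δ : ℝ, 0 < δ ∧ ∀ (k : ℤ) (n : ℕ),
        δ ≤ c ^ n * ∏ j ∈ Finset.Icc 1 n, ‖w (k + (j : ℤ))‖) := by
  obtain ⟨X, hX⟩ := similarOp_iff_graph.mp h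
  set Y : EllTwoZ →L[ℂ] EllTwoZ := (X.symm : EllTwoZ →L[ℂ] EllTwoZ) with hY
  set f : ℤ → EllTwoZ := fun k => X (stdVec k) with hf
  set g : ℤ → EllTwoZ := fun k => Y.adjoint (stdVec k) with hg
  have hNf : ∀ k, (f k, w k • f (k + 1)) ∈ N.graph := fun k => by
    have := (hX _ _).mp (stdVec_mem_graph w k)
    rwa [map_smul] at this
  have hNg : ∀ k, (g (k + 1), starRingEnd ℂ (w k) • g k) ∈ N.adjoint.graph := fun k => by
    rw [LinearPMap.adjoint_graph_eq_graph_adjoint hN.dense_domain, Submodule.mem_adjoint_iff]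
    intro a b hab
    have h1 : (Y a, Y b) ∈ (weightedShift w).graph := by
      rw [hX]
      simpa [hY] using hab
    have h2 := mem_graph_weightedShift.mp h1 k
    simp only [hg]
    rw [inner_smul_right, ContinuousLinearMap.adjoint_inner_right,
      ContinuousLinearMap.adjoint_inner_right, ← inner_conj_symm, inner_stdVec,
      ← inner_conj_symm (Y a), inner_stdVec, h2, map_mul]
    ring
  have hfg : ∀ k, inner ℂ (g k) (f k) = (1 : ℂ) := fun k => by
    simp only [hg, hf]
    rw [ContinuousLinearMap.adjoint_inner_left]
    simp [hY, stdVec]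
  have hf0 : ∀ k, 0 < ‖f k‖ := fun k => norm_pos_iff.mpr fun h0 => by
    have := hfg k
    simp [h0] at this
  have hg0 : ∀ k, 0 < ‖g k‖ := fun k => norm_pos_iff.mpr fun h0 => by
    have := hfg k
    simp [h0] at this
  have hfle : ∀ k, ‖f k‖ ≤ ‖(X : EllTwoZ →L[ℂ] EllTwoZ)‖ := fun k => by
    simpa [norm_stdVec] using (X : EllTwoZ →L[ℂ] EllTwoZ).le_opNorm (stdVec k)
  have hgle : ∀ k, ‖g k‖ ≤ ‖Y‖ := fun k => by
    simpa [norm_stdVec] using Y.adjoint.le_opNorm (stdVec k)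
  have hω : ∀ k, 0 < ‖w k‖ := fun k => norm_pos_iff.mpr (hw k)
  obtain ⟨ρ, hρ, hwρ⟩ := exists_weight_eq_mul_div (ω := fun k => ‖w k‖) (a := fun k => ‖f k‖)
    (b := fun k => ‖g k‖) hω hf0 hg0
    (fun k => mul_le_mul (hfle k) (hgle k) (norm_nonneg _) (norm_nonneg _))
    (fun k => by
      have h1 := hNf (k - 1)
      rw [sub_add_cancel] at h1
      have h2 := hN.norm_sq_le h1 (N.graph.smul_mem (w (k - 1)) (hNf k))
      simp only [norm_smul] at h2
      refine le_of_mul_le_mul_left ?_ (hω (k - 1))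
      linarith)
    (fun k => by
      have h1 := hNg k
      have h3 := hNg (k - 1)
      rw [sub_add_cancel] at h3
      have h2 := hN.norm_sq_le_adjoint h1 (N.adjoint.graph.smul_mem (starRingEnd ℂ (w k)) h3)
      simp only [norm_smul, RCLike.norm_conj] at h2
      refine le_of_mul_le_mul_left ?_ (hω k)
      linarith)
  have hprod := pow_mul_prod_eq_div hρ hf0 hwρ
  have hY0 : 0 < ‖Y‖ := (hg0 0).trans_le (hgle 0)
  have hX0 : 0 < ‖(X : EllTwoZ →L[ℂ] EllTwoZ)‖ := (hf0 0).trans_le (hfle 0)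
  -- The lower bound on `‖f k‖` comes from the biorthogonality `⟪g k, f k⟫ = 1`.
  have hflb : ∀ k, ‖Y‖⁻¹ ≤ ‖f k‖ := fun k => by
    rw [inv_le_iff_one_le_mul₀ hY0]
    have := norm_inner_le_norm (𝕜 := ℂ) (g k) (f k)
    rw [hfg, norm_one] at this
    nlinarith [hgle k, hf0 k]
  refine ⟨ρ⁻¹, inv_pos.mpr hρ, ⟨‖(X : EllTwoZ →L[ℂ] EllTwoZ)‖ / ‖Y‖⁻¹, fun k n => ?_⟩,
    ‖Y‖⁻¹ / ‖(X : EllTwoZ →L[ℂ] EllTwoZ)‖, by positivity, fun k n => ?_⟩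
  · rw [hprod]
    exact div_le_div₀ hX0.le (hfle _) (by positivity) (hflb _)
  · rw [hprod]
    exact div_le_div₀ (hf0 _).le (hflb _) (hf0 _) (hfle _)

end Shifts

theorem theorem1 (w : ℤ → ℂ) (hw : Function.Injective (weightedShift w)) :
    List.TFAE
      [∃ N : EllTwoZ →ₗ.[ℂ] EllTwoZ, IsNormalOp N ∧ SimilarOp (weightedShift w) N,
       ∃ c : ℝ, 0 < c ∧ SimilarOp ((c : ℂ) • weightedShift w) simpleShift,
       ∃ c : ℝ, 0 < c ∧
         (∃ M : ℝ, ∀ (k : ℤ) (n : ℕ),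
           c ^ n * ∏ j ∈ Finset.Icc 1 n, ‖w (k + (j : ℤ))‖ ≤ M) ∧
         (∃ δ : ℝ, 0 < δ ∧ ∀ (k : ℤ) (n : ℕ),
           δ ≤ c ^ n * ∏ j ∈ Finset.Icc 1 n, ‖w (k + (j : ℤ))‖)] := by
  have hw0 := weight_ne_zero_of_injective hw
  tfae_have 1 → 3 := fun ⟨_, hN, h⟩ => exists_bounds_of_similarOp_isNormalOp hw0 hN h
  tfae_have 3 → 2 := fun ⟨c, hc, ⟨_, hM⟩, _, hδ, hm⟩ =>
    ⟨c, hc, similarOp_simpleShift_of_bounds hw0 hc hδ hM hm⟩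
  tfae_have 2 → 1 := fun ⟨_, hc, h⟩ =>
    exists_isNormalOp_of_similarOp_simpleShift (by exact_mod_cast hc.ne') h
  tfae_finish
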